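/- Let $L$ be a non-trivial compact metrizable abelian topological group and let $I$ be an uncountable set with $|I|\le\mathfrak c$, where $\mathfrak c$ is the cardinality of the continuum. Equip $L^I$ with the product topology. Then $L^I$ contains a $G_\delta$-dense subgroup $D$ (that is, $D$ meets every non-empty $G_\delta$-subset of $L^I$) such that $|D|=\mathfrak c$ and all compact subsets of $D$ are countable; in particular, $D$ is not $w$-compact, i.e. no compact subset $C$ of $D$ satisfies $w(C)=w(D)$, where the weight $w(X)$ of a space $X$ is the least cardinality of a base of its topology. Furthermore, if $L$ is unbounded (that is, there is no integer $n\ge 1$ with $nx=0$ for all $x\in L$), then $D$ with all these properties can be chosen to be, in addition, a free abelian group. -/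

import Mathlib

open Cardinal TopologicalSpace

universe u v

/-- A subset `D` of a space is `G_δ`-dense if it meets every non-empty `G_δ`-subset. -/
def IsGδDense {X : Type u} [TopologicalSpace X] (D : Set X) : Prop :=
  ∀ B : Set X, IsGδ B → B.Nonempty → (D ∩ B).Nonempty

/-- The weight of a space: the least cardinality of a base of its topology. -/
noncomputable def topWeight (X : Type u) [TopologicalSpace X] : Cardinal.{u} :=
  sInf {κ : Cardinal.{u} | ∃ B : Set (Set X), IsTopologicalBasis B ∧ #B = κ}

/-- A space is `w`-compact if it has a compact subset (with the subspace topology) of the same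
weight as the whole space. -/
def WCompact (X : Type u) [TopologicalSpace X] : Prop :=
  ∃ C : Set X, IsCompact C ∧ topWeight C = topWeight X

/-! A Bernstein argument gives `𝔠` points of `2^ω` such that every compact set of them is countable.
Put `N = ℤ × Clopens (2^ω)`. `cantorVec` sends these points into `L^N`, and compact subsets of the
subgroup `range β` generated by their images are still countable
(`countable_of_isCompact_subset_range`).

Since `|I × N| = |I|`, `L^I` can be read as `(L^N)^I`. There are at most `𝔠` codes `q` for countable
partial functions `I → L^N`. Each is extended off its countable domain by its own constant
`cantorVec z (e q)`, and `D` is generated by these extensions. Realizing every countable partial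
function makes `D` `G_δ`-dense, of size at least `𝔠` and not second countable. Every element of `D`
is constant off a countable set and is determined by that eventual value, so a compact subset of `D`
injects into a compact subset of `range β` (`countable_of_isCompact_of_eventual_value`). A relation
among the generators has coefficients that annihilate `L`, so for unbounded `L` they are free. -/

/-! ### A Bernstein-type set in the Cantor space. -/

/-- A family of at most `κ` sets of cardinality at least `κ` has an injective choice function. -/
theorem exists_injective_choice {ι X : Type u} (A : ι → Set X) (hA : ∀ i, #ι ≤ #(A i)) :
    ∃ f : ι → X, Function.Injective f ∧ ∀ i, f i ∈ A i := by
  -- In a well-order of least type every initial segment is smaller than `ι`, so earlier choices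
  -- never exhaust `A i`.
  obtain ⟨r, wo, hr⟩ := Cardinal.exists_ord_eq ι
  have step (i : ι) (g : ∀ j, r j i → X) : ∃ x ∈ A i, ∀ j (h : r j i), g j h ≠ x := by
    by_contra! H
    have hsub : A i ⊆ Set.range fun j : {j // r j i} => g j.1 j.2 := fun x hx => by
      obtain ⟨j, h, e⟩ := H x hx
      exact ⟨⟨j, h⟩, e⟩
    have h1 : #(A i) ≤ #{j // r j i} := (mk_le_mk_of_subset hsub).trans mk_range_le
    have h2 : #{j // r j i} < #ι := by
      have := Cardinal.card_typein_lt i hr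
      rwa [Ordinal.card_typein] at this
    exact absurd ((hA i).trans h1) h2.not_ge
  choose F hF hF' using step
  let f : ι → X := wo.toIsWellFounded.wf.fix F
  have hf (i : ι) : f i = F i fun j _ => f j := wo.toIsWellFounded.wf.fix_eq F i
  refine ⟨f, ?_, fun i => by rw [hf]; exact hF _ _⟩
  intro i j hij
  by_contra hne
  rcases (trichotomous_of r i j) with h | h | h
  · exact hF' j (fun k _ => f k) i h (by rw [← hf]; exact hij)
  · exact hne h
  · exact hF' i (fun k _ => f k) j h (by rw [← hf]; exact hij.symm)

/-- A Bernstein-type set: a copy of the continuum in the Cantor space all of whose compact subsets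
are countable. -/
theorem exists_injective_range_compact_countable :
    ∃ e : (ℕ → Bool) → (ℕ → Bool), Function.Injective e ∧
      ∀ K ⊆ Set.range e, IsCompact K → K.Countable := by
  have : PolishSpace Bool := {}
  let 𝒦 : Set (Set (ℕ → Bool)) := {K | IsClosed K ∧ ¬ K.Countable}
  have h𝒦 : #𝒦 ≤ 𝔠 := by
    refine le_trans (mk_le_mk_of_subset fun K hK => ?_)
      (MeasurableSpace.cardinal_measurableSet_le_continuum (α := ℕ → Bool)
        (s := countableBasis (ℕ → Bool)) ?_)
    · have := hK.1.measurableSet (α := ℕ → Bool)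
      rw [(isBasis_countableBasis (ℕ → Bool)).borel_eq_generateFrom.symm,
        ← BorelSpace.measurable_eq (α := ℕ → Bool)]
      exact this
    · exact (countable_countableBasis _).le_aleph0.trans aleph0_le_continuum
  have hX : #(ℕ → Bool) = 𝔠 := by simp
  -- The `inr` points form the desired set; the `inl` points reserve one point outside it in each
  -- uncountable closed set.
  obtain ⟨f, hf, hfA⟩ := exists_injective_choice
    (ι := 𝒦 ⊕ (ℕ → Bool)) (X := ℕ → Bool) (Sum.elim (fun K => K.1) fun _ => Set.univ) (by
      have hι : #(𝒦 ⊕ (ℕ → Bool)) ≤ 𝔠 := by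
        rw [mk_sum, lift_id, lift_id, hX]
        exact (add_le_add_left h𝒦 _).trans continuum_add_self.le
      rintro (K | s)
      · obtain ⟨g, hg, -, hinj⟩ := K.2.1.exists_nat_bool_injection_of_not_countable K.2.2
        refine hι.trans (hX ▸ ?_)
        exact mk_le_of_injective (f := fun s => (⟨g s, hg ⟨s, rfl⟩⟩ : K.1))
          fun a b h => hinj (congrArg Subtype.val h)
      · simpa using hι)
  refine ⟨f ∘ Sum.inr, hf.comp Sum.inr_injective, fun K hK hc => ?_⟩
  by_contra hn
  obtain ⟨s, hs⟩ := hK (hfA (Sum.inl ⟨K, hc.isClosed, hn⟩))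
  exact Sum.inr_ne_inl (hf hs)

/-! ### Combinations of Cantor vectors and their compact sets. -/

theorem exists_clopens_mem_disjoint_finset {X : Type*} [TopologicalSpace X] [CompactSpace X]
    [T2Space X] [TotallyDisconnectedSpace X] (F : Finset X) {s : X} (hs : s ∉ F) (U : Clopens X)
    (hU : s ∈ U) :
    ∃ V ≤ U, s ∈ V ∧ ∀ t ∈ F, t ∉ V := by
  obtain ⟨V, hV, hsV, hVU⟩ := compact_exists_isClopen_in_isOpen
    (U.isClopen.isOpen.inter F.finite_toSet.isClosed.isOpen_compl) ⟨hU, hs⟩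
  exact ⟨⟨V, hV⟩, fun x hx => (hVU hx).1, hsV, fun t ht hV => (hVU hV).2 ht⟩

section CantorVec

variable {L : Type u} [AddCommGroup L] {Q : Type v}

open Classical in
/-- The element of `L ^ (ℤ × Clopens 2^ω)` with coordinates `1_U(s) z_l`. -/
noncomputable def cantorVec (z : ℤ → L) (s : ℕ → Bool) : ℤ × Clopens (ℕ → Bool) → L :=
  fun n => if s ∈ n.2 then z n.1 else 0

open Classical in
theorem linearCombination_cantorVec_apply (z : ℤ → L) (e : Q → ℕ → Bool) (p : Q →₀ ℤ) (l : ℤ)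
    (V : Clopens (ℕ → Bool)) :
    Finsupp.linearCombination ℤ (fun q => cantorVec z (e q)) p (l, V) =
      ∑ q ∈ p.support, if e q ∈ V then p q • z l else 0 := by
  rw [Finsupp.linearCombination_apply, Finsupp.sum, Finset.sum_apply]
  refine Finset.sum_congr rfl fun q _ => ?_
  by_cases h : e q ∈ V <;> simp [cantorVec, h]

theorem exists_clopens_isolating {e : Q → ℕ → Bool} (he : e.Injective) (p : Q →₀ ℤ) (q : Q) :
    ∃ U : Clopens (ℕ → Bool), e q ∈ U ∧ ∀ q' ∈ p.support, q' ≠ q → e q' ∉ U := by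
  classical
  obtain ⟨U, -, h, h'⟩ := exists_clopens_mem_disjoint_finset ((p.support.erase q).image e)
    (s := e q) (by simp [he.eq_iff]) ⊤ trivial
  exact ⟨U, h, fun q' hq' hne => h' _
    (Finset.mem_image_of_mem _ (Finset.mem_erase.2 ⟨hne, hq'⟩))⟩

open Classical in
theorem linearCombination_cantorVec_isolating (z : ℤ → L) {e : Q → ℕ → Bool} {p : Q →₀ ℤ} {q : Q}
    {U V : Clopens (ℕ → Bool)} (hU : ∀ q' ∈ p.support, q' ≠ q → e q' ∉ U) (hV : V ≤ U) (l : ℤ) :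
    Finsupp.linearCombination ℤ (fun q => cantorVec z (e q)) p (l, V) =
      if e q ∈ V then p q • z l else 0 := by
  rw [linearCombination_cantorVec_apply]
  apply Finset.sum_eq_single q
  · intro q' hq' hne
    rw [if_neg fun h => hU q' hq' hne (hV h)]
  · intro h
    simp [Finsupp.notMem_support_iff.1 h]

/-- On a clopen isolating `e q` only the coefficient `p q` survives; it is tested against `z (p q)`,
which decides whether `p q` annihilates `L`. -/
theorem smul_eq_zero_of_linearCombination_cantorVec {z : ℤ → L}
    (hz : ∀ n : ℤ, n • z n = 0 → ∀ x : L, n • x = 0) {e : Q → ℕ → Bool} (he : e.Injective)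
    {p : Q →₀ ℤ} (hp : Finsupp.linearCombination ℤ (fun q => cantorVec z (e q)) p = 0) (q : Q)
    (x : L) : p q • x = 0 := by
  obtain ⟨U, hq, hU⟩ := exists_clopens_isolating he p q
  refine hz _ ?_ x
  have := linearCombination_cantorVec_isolating z hU le_rfl (p q)
  rwa [hp, if_pos hq, Pi.zero_apply, eq_comm] at this

/-- Each coefficient that does not annihilate `L` is visible on an isolating clopen, which places
its point in one of countably many countable sets `S U n`. Hence `K` lies in the span of countably
many vectors. -/
theorem countable_of_isCompact_subset_range [TopologicalSpace L] [T2Space L] {z : ℤ → L}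
    (hz : ∀ n : ℤ, n • z n = 0 → ∀ x : L, n • x = 0)
    {e : Q → ℕ → Bool} (he : e.Injective)
    (hc : ∀ K ⊆ Set.range e, IsCompact K → K.Countable) {K : Set (ℤ × Clopens (ℕ → Bool) → L)}
    (hK : IsCompact K)
    (hKr : K ⊆ Set.range (Finsupp.linearCombination ℤ fun q => cantorVec z (e q))) :
    K.Countable := by
  classical
  have : Countable (Clopens (ℕ → Bool)) :=
    TopologicalSpace.Clopens.countable_iff_secondCountable.2 inferInstance
  -- Points `s` for which some member of `K` looks, below `U`, like `n` times the vector of `s`;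
  -- this is a projection of a closed subset of `K × U`.
  let S (U : Clopens (ℕ → Bool)) (n : ℤ) : Set (ℕ → Bool) :=
    {s | s ∈ U ∧ ∃ m ∈ K, ∀ V ≤ U, ∀ l, m (l, V) = if s ∈ V then n • z l else 0}
  have hScomp (U n) : IsCompact (S U n) := by
    have hcl : IsClosed {a : (ℤ × Clopens (ℕ → Bool) → L) × (ℕ → Bool) |
        ∀ V ≤ U, ∀ l, a.1 (l, V) = if a.2 ∈ V then n • z l else 0} := by
      simp only [Set.ofPred_forall]
      refine isClosed_iInter fun V => isClosed_iInter fun _ => isClosed_iInter fun l => ?_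
      refine isClosed_eq (by fun_prop) ?_
      have : Continuous fun s : ℕ → Bool => if s ∈ V then n • z l else 0 :=
        continuous_const.if (p := (· ∈ V))
          (fun s hs => by
            have h : s ∈ frontier (V : Set (ℕ → Bool)) := hs
            rw [V.isClopen.frontier_eq] at h
            exact h.elim)
          continuous_const
      exact this.comp continuous_snd
    convert ((hK.prod U.isClopen.isClosed.isCompact).inter_right hcl).image continuous_snd using 1
    ext s
    constructor
    · rintro ⟨hs, m, hm, h⟩
      exact ⟨(m, s), ⟨⟨hm, hs⟩, h⟩, rfl⟩
    · rintro ⟨⟨m, t⟩, ⟨⟨hm, hs⟩, h⟩, rfl⟩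
      exact ⟨hs, m, hm, h⟩
  have hScount (U n) (hn : n • z n ≠ 0) : (S U n).Countable := by
    refine hc _ (fun s hs => ?_) (hScomp U n)
    obtain ⟨hsU, m, hm, h⟩ := hs
    obtain ⟨p, rfl⟩ := hKr hm
    -- Otherwise a clopen around `s` misses the finite support, and one coordinate would equal both
    -- `0` and `n • z n`.
    by_contra hse
    obtain ⟨V, hVU, hsV, hV⟩ := exists_clopens_mem_disjoint_finset (p.support.image e) (s := s)
      (by
        simp only [Finset.mem_image, not_exists, not_and]
        exact fun q _ h => hse ⟨q, h⟩) U hsU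
    have h1 := h V hVU n
    rw [if_pos hsV, linearCombination_cantorVec_apply, Finset.sum_eq_zero] at h1
    · exact hn h1.symm
    · intro q hq
      rw [if_neg (hV _ (Finset.mem_image_of_mem _ hq))]
  let T : Set (ℕ → Bool) := ⋃ (U) (n : ℤ) (_ : n • z n ≠ 0), S U n
  have hT : T.Countable := Set.countable_iUnion fun U => Set.countable_iUnion fun n =>
    Set.countable_iUnion fun hn => hScount U n hn
  have hspan : (Submodule.span ℤ (cantorVec z '' T)).carrier.Countable := by
    have := (hT.image (cantorVec z)).to_subtype
    have h := Finsupp.span_eq_range_linearCombination ℤ (cantorVec z '' T)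
    rw [h]
    exact Set.countable_range _
  refine hspan.mono fun m hm => ?_
  obtain ⟨p, rfl⟩ := hKr hm
  rw [Finsupp.linearCombination_apply]
  refine Submodule.sum_mem _ fun q _ => ?_
  by_cases hq : p q • z (p q) = 0
  · have : p q • cantorVec z (e q) = 0 := by
      ext n
      exact hz _ hq _
    exact (congrArg (· ∈ _) this).mpr (Submodule.zero_mem _)
  · refine Submodule.smul_mem _ _ (Submodule.subset_span ⟨_, ?_, rfl⟩)
    obtain ⟨U, hqU, hU⟩ := exists_clopens_isolating he p q
    refine Set.mem_iUnion₂.2 ⟨U, p q, Set.mem_iUnion.2 ⟨hq, hqU, _, hm, fun V hV l => ?_⟩⟩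
    exact linearCombination_cantorVec_isolating z hU hV l

end CantorVec

/-! ### Functions constant off a countable set. -/

/-- If the points `ψ p` of `I → M` are determined by their eventual values `β p` and compact subsets
of the set of eventual values are countable, then so are compact subsets of `range ψ`. -/
theorem countable_of_isCompact_of_eventual_value {I M P : Type*} [Uncountable I]
    [TopologicalSpace M] [T2Space M] [SecondCountableTopology M] {ψ : P → I → M} {β : P → M}
    (hψ : ∀ p, ∃ J : Set I, J.Countable ∧ ∀ i ∉ J, ψ p i = β p)
    (hβ : ∀ p p', β p = β p' → ψ p = ψ p')
    (hK : ∀ K ⊆ Set.range β, IsCompact K → K.Countable)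
    {C : Set (I → M)} (hC : IsCompact C) (hCψ : C ⊆ Set.range ψ) : C.Countable := by
  choose J hJ hJψ using hψ
  obtain ⟨t, htc, htd⟩ := exists_countable_dense (β '' (ψ ⁻¹' C))
  rw [Subtype.dense_iff] at htd
  have ht (y : β '' (ψ ⁻¹' C)) : ∃ p, ψ p ∈ C ∧ β p = y := y.2
  choose r hrC hrβ using ht
  -- Off a countable set, all representatives of the countable dense set of eventual values are
  -- constant at once.
  let T : Set I := (⋃ y ∈ t, J (r y))ᶜ
  have hTc : Tᶜ.Countable := by
    rw [compl_compl]
    exact htc.biUnion fun y _ => hJ _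
  have hT (p : P) : ∃ i ∈ T, ψ p i = β p := by
    obtain ⟨i, hi⟩ : (Tᶜ ∪ J p)ᶜ.Nonempty := by
      rw [Set.nonempty_compl]
      intro h
      exact Set.not_countable_univ (h ▸ hTc.union (hJ p))
    simp only [Set.compl_union, compl_compl] at hi
    exact ⟨i, hi.1, hJψ p i hi.2⟩
  let C' : Set (I → M) := C ∩ {d | ∀ i ∈ T, ∀ j ∈ T, d i = d j}
  have hC' : IsCompact C' := by
    refine hC.inter_right ?_
    simp only [Set.ofPred_forall]
    exact isClosed_iInter fun i => isClosed_iInter fun _ => isClosed_iInter fun j =>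
      isClosed_iInter fun _ => isClosed_eq (continuous_apply i) (continuous_apply j)
  have hval (p : P) (hp : ψ p ∈ C') (i : I) (hi : i ∈ T) : ψ p i = β p := by
    obtain ⟨j, hj, e⟩ := hT p
    rw [← e]
    exact hp.2 i hi j hj
  by_cases hne : C.Nonempty
  swap
  · rw [Set.not_nonempty_iff_eq_empty.1 hne]
    exact Set.countable_empty
  obtain ⟨i₀, hi₀⟩ : T.Nonempty := by
    obtain ⟨d, hd⟩ := hne
    obtain ⟨p, rfl⟩ := hCψ hd
    obtain ⟨i, hi, -⟩ := hT p
    exact ⟨i, hi⟩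
  have himg : IsCompact ((fun d : I → M => d i₀) '' C') := hC'.image (continuous_apply i₀)
  -- The compact image of `C'` contains a dense set of eventual values, hence all of them.
  have hsub : β '' (ψ ⁻¹' C) ⊆ (fun d : I → M => d i₀) '' C' := by
    refine htd.trans (closure_minimal ?_ himg.isClosed)
    rintro _ ⟨y, hy, rfl⟩
    have hr : ψ (r y) ∈ C' := by
      refine ⟨hrC y, fun i hi j hj => ?_⟩
      simp only [T, Set.mem_compl_iff, Set.mem_iUnion, not_exists] at hi hj
      rw [hJψ _ i (hi y hy), hJψ _ j (hj y hy)]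
    exact ⟨ψ (r y), hr, (hval _ hr _ hi₀).trans (hrβ y)⟩
  have hCC' : C ⊆ C' := by
    intro d hd
    obtain ⟨p, rfl⟩ := hCψ hd
    obtain ⟨d', hd', e⟩ := hsub ⟨p, hd, rfl⟩
    obtain ⟨p', rfl⟩ := hCψ hd'.1
    rw [hβ p p' (e.symm.trans (hval _ hd' _ hi₀))]
    exact hd'
  have hcount : ((fun d : I → M => d i₀) '' C').Countable := by
    refine hK _ ?_ himg
    rintro _ ⟨d, hd, rfl⟩
    obtain ⟨p, rfl⟩ := hCψ hd.1
    exact ⟨p, (hval _ hd _ hi₀).symm⟩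
  refine (Set.countable_of_injective_of_countable_image ?_ hcount).mono hCC'
  intro d hd d' hd' e
  obtain ⟨p, rfl⟩ := hCψ hd.1
  obtain ⟨p', rfl⟩ := hCψ hd'.1
  refine hβ _ _ ?_
  rw [← hval _ hd _ hi₀, ← hval _ hd' _ hi₀]
  exact e

/-! ### Cardinal bounds and construction of the generators. -/

theorem mk_le_continuum_of_secondCountable (X : Type u) [TopologicalSpace X] [T0Space X]
    [SecondCountableTopology X] : #X ≤ 𝔠 := by
  have h : Function.Injective fun x : X => {B : countableBasis X | x ∈ B.1} := by
    intro x y hxy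
    refine ((isBasis_countableBasis X).inseparable_iff.2 fun B hB => ?_).eq
    have := Set.ext_iff.1 hxy ⟨B, hB⟩
    exact this
  refine (mk_le_of_injective h).trans ?_
  rw [mk_set, ← two_power_aleph0]
  exact power_le_power_left two_ne_zero (countable_countableBasis X).le_aleph0

theorem mk_fun_le_continuum {ι : Type u} {A : Type v} [Countable ι] (hA : #A ≤ 𝔠) :
    #(ι → A) ≤ 𝔠 := by
  rw [mk_pi, prod_const, ← continuum_power_aleph0]
  exact (power_le_power_right (lift_le_continuum.2 hA)).trans
    (power_le_power_left continuum_ne_zero (lift_le_aleph0.2 mk_le_aleph0))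

open Classical in
/-- The point of `I → M` that takes the values `g m` at the points `f m` and the constant value
`c` elsewhere. -/
noncomputable def patch {I M : Type*} (f : ℕ → I) (g : ℕ → M) (c : M) (i : I) : M :=
  if h : ∃ m, f m = i then g h.choose else c

theorem patch_of_notMem {I M : Type*} (f : ℕ → I) (g : ℕ → M) (c : M) {i : I}
    (hi : i ∉ Set.range f) : patch f g c i = c :=
  dif_neg hi

theorem patch_comp_of_mem {I M : Type*} (f : ℕ → I) (y : I → M) (c : M) {i : I}
    (hi : i ∈ Set.range f) : patch f (y ∘ f) c i = y i := by
  have h : ∃ m, f m = i := hi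
  rw [patch, dif_pos h]
  exact congrArg y h.choose_spec

/-- `L ^ I` contains the image of a free abelian group that realizes all partial functions on
countable sets and has only countable compact subsets. -/
theorem exists_linearMap_finsupp {L : Type u} [AddCommGroup L] [TopologicalSpace L]
    [T2Space L] [SecondCountableTopology L] {I : Type v} (hI : ℵ₀ < #I) (hI' : #I ≤ 𝔠) :
    ∃ (Q : Type (max u v)) (Φ : (Q →₀ ℤ) →ₗ[ℤ] (I → L)),
      (∀ (J : Set I), J.Countable → ∀ y : I → L, ∃ p, ∀ i ∈ J, Φ p i = y i) ∧
      (∀ C : Set (I → L), C ⊆ Set.range Φ → IsCompact C → C.Countable) ∧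
      (∀ p, Φ p = 0 → ∀ q (x : L), p q • x = 0) ∧ #Q ≤ 𝔠 := by
  have : Countable (Clopens (ℕ → Bool)) :=
    TopologicalSpace.Clopens.countable_iff_secondCountable.2 inferInstance
  have : Uncountable I := by rwa [← aleph0_lt_mk_iff]
  let N := ℤ × Clopens (ℕ → Bool)
  obtain ⟨σ⟩ : Nonempty (I × N ≃ I) := by
    rw [← Cardinal.eq, mk_prod, lift_uzero]
    refine mul_eq_left hI.le ?_ ?_
    · exact (lift_le_aleph0.2 mk_le_aleph0).trans hI.le
    · exact lift_eq_zero.not.2 (mk_ne_zero N)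
  have hL : #L ≤ 𝔠 := mk_le_continuum_of_secondCountable L
  -- A code lists a countable subset of `I` together with values in `L^N`.
  let Q := (ℕ → I) × (ℕ → N → L)
  have hQ : #Q ≤ 𝔠 := by
    rw [mk_prod, ← continuum_mul_self]
    exact mul_le_mul' (lift_le_continuum.2 (mk_fun_le_continuum hI'))
      (lift_le_continuum.2 (mk_fun_le_continuum (mk_fun_le_continuum hL)))
  obtain ⟨e₀, he₀, hc₀⟩ := exists_injective_range_compact_countable
  obtain ⟨j, hj⟩ : ∃ j : Q → ℕ → Bool, Function.Injective j := by
    obtain ⟨j⟩ : Nonempty (Q ↪ (ℕ → Bool)) := by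
      rw [← lift_mk_le']
      simpa using hQ
    exact ⟨j, j.injective⟩
  let e := e₀ ∘ j
  have he : e.Injective := he₀.comp hj
  have hc : ∀ K ⊆ Set.range e, IsCompact K → K.Countable := fun K hK =>
    hc₀ K (hK.trans (Set.range_comp_subset_range _ _))
  -- `z n` witnesses that `n` does not annihilate `L`, whenever that is so.
  have hz (n : ℤ) : ∃ z : L, n • z = 0 → ∀ x : L, n • x = 0 := by
    by_cases h : ∀ x : L, n • x = 0
    · exact ⟨0, fun _ => h⟩
    · push Not at h
      obtain ⟨x, hx⟩ := h
      exact ⟨x, fun h => absurd h hx⟩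
  choose z hz using hz
  let β : (Q →₀ ℤ) →ₗ[ℤ] (N → L) := Finsupp.linearCombination ℤ fun q => cantorVec z (e q)
  let Ψ : (Q →₀ ℤ) →ₗ[ℤ] (I → N → L) :=
    Finsupp.linearCombination ℤ fun q => patch q.1 q.2 (cantorVec z (e q))
  let Φ : (Q →₀ ℤ) →ₗ[ℤ] (I → L) :=
    Finsupp.linearCombination ℤ fun q k =>
      patch q.1 q.2 (cantorVec z (e q)) (σ.symm k).1 (σ.symm k).2
  have hΦΨ (p i n) : Φ p (σ (i, n)) = Ψ p i n := by
    simp only [Φ, Ψ, Finsupp.linearCombination_apply, Finsupp.sum, Finset.sum_apply]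
    refine Finset.sum_congr rfl fun q _ => ?_
    simp
  have hΨ (p) : ∃ J : Set I, J.Countable ∧ ∀ i ∉ J, Ψ p i = β p := by
    refine ⟨⋃ q ∈ p.support, Set.range q.1, p.support.countable_toSet.biUnion fun q _ =>
      Set.countable_range _, fun i hi => ?_⟩
    simp only [Set.mem_iUnion, not_exists] at hi
    simp only [Ψ, β, Finsupp.linearCombination_apply, Finsupp.sum, Finset.sum_apply]
    refine Finset.sum_congr rfl fun q hq => ?_
    rw [Pi.smul_apply, patch_of_notMem _ _ _ (hi q hq)]
  have hβ0 (p) (hp : β p = 0) (q) (x : L) : p q • x = 0 :=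
    smul_eq_zero_of_linearCombination_cantorVec hz he hp q x
  have hβΨ (p) (hp : β p = 0) : Ψ p = 0 := by
    simp only [Ψ, Finsupp.linearCombination_apply]
    refine Finset.sum_eq_zero fun q _ => ?_
    ext i n
    exact hβ0 p hp q _
  refine ⟨Q, Φ, ?_, ?_, ?_, hQ⟩
  · intro J hJ y
    obtain ⟨i₀⟩ : Nonempty I := inferInstance
    -- The extra point `i₀` only ensures that the set can be enumerated when `J` is empty.
    obtain ⟨f, hf⟩ := ((hJ.image fun k => (σ.symm k).1).insert i₀).exists_eq_range
      (Set.insert_nonempty _ _)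
    refine ⟨Finsupp.single (f, (fun i n => y (σ (i, n))) ∘ f) 1, fun k hk => ?_⟩
    have hk' : (σ.symm k).1 ∈ Set.range f := hf ▸ Set.mem_insert_of_mem _ ⟨k, hk, rfl⟩
    simp [Φ, patch_comp_of_mem f _ _ hk']
  · intro C hC hCc
    let blk : (I → L) → I → N → L := fun x i n => x (σ (i, n))
    have hblk : Continuous blk := by fun_prop
    have hinj : Function.Injective blk := by
      intro x x' h
      ext k
      have := congrFun (congrFun h (σ.symm k).1) (σ.symm k).2
      simpa [blk] using this
    refine Set.countable_of_injective_of_countable_image (f := blk) hinj.injOn ?_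
    refine countable_of_isCompact_of_eventual_value (ψ := Ψ) (β := β) hΨ ?_ ?_
      (hCc.image hblk) ?_
    · intro p p' h
      rw [← sub_eq_zero, ← map_sub]
      exact hβΨ _ (by rw [map_sub, sub_eq_zero, h])
    · exact fun K hK hKc => countable_of_isCompact_subset_range hz he hc hKc hK
    · rintro _ ⟨d, hd, rfl⟩
      obtain ⟨p, rfl⟩ := hC hd
      exact ⟨p, by ext i n; exact (hΦΨ p i n).symm⟩
  · intro p hp
    refine hβ0 p ?_
    obtain ⟨J, hJ, h⟩ := hΨ p
    obtain ⟨i, hi⟩ : Jᶜ.Nonempty := by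
      rw [Set.nonempty_compl]
      intro h
      exact Set.not_countable_univ (h ▸ hJ)
    rw [← h i hi]
    ext n
    rw [← hΦΨ, hp]
    rfl

/-! ### Consequences of realizing countable partial functions: density, size, weight. -/

theorem isGδDense_of_interpolation {I : Type v} {L : Type u} [TopologicalSpace L]
    {D : Set (I → L)}
    (hD : ∀ J : Set I, J.Countable → ∀ y : I → L, ∃ d ∈ D, ∀ i ∈ J, d i = y i) :
    IsGδDense D := by
  rintro B ⟨𝒰, hopen, hcount, rfl⟩ ⟨y, hy⟩
  have h (U : 𝒰) : ∃ F : Finset I, ∀ d : I → L, (∀ i ∈ F, d i = y i) → d ∈ U.1 := by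
    obtain ⟨F, u, hu, hsub⟩ := isOpen_pi_iff.1 (hopen U.1 U.2) y (hy U.1 U.2)
    exact ⟨F, fun d hd => hsub fun i hi => by rw [hd i hi]; exact (hu i hi).2⟩
  choose F hF using h
  have := hcount.to_subtype
  obtain ⟨d, hdD, hd⟩ := hD (⋃ U, F U) (Set.countable_iUnion fun U => (F U).countable_toSet) y
  exact ⟨d, hdD, fun U hU => hF ⟨U, hU⟩ d fun i hi => hd i (Set.mem_iUnion.2 ⟨⟨U, hU⟩, hi⟩)⟩

theorem continuum_le_mk_of_interpolation {I : Type v} {L : Type u} [Infinite I] [Nontrivial L]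
    {D : Set (I → L)}
    (hD : ∀ J : Set I, J.Countable → ∀ y : I → L, ∃ d ∈ D, ∀ i ∈ J, d i = y i) : 𝔠 ≤ #D := by
  obtain ⟨a, b, hab⟩ := exists_pair_ne L
  let f := Infinite.natEmbedding I
  have h (s : ℕ → Bool) : ∃ d ∈ D, ∀ n, d (f n) = if s n then a else b := by
    obtain ⟨d, hd, h⟩ := hD (Set.range f) (Set.countable_range f)
      (Function.extend f (fun n => if s n then a else b) fun _ => a)
    exact ⟨d, hd, fun n => by rw [h _ ⟨n, rfl⟩, f.injective.extend_apply]⟩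
  choose d hdD hd using h
  have hinj : Function.Injective fun s => (⟨d s, hdD s⟩ : D) := by
    intro s t hst
    ext1 n
    have := congrFun (congrArg Subtype.val hst) (f n)
    simp only [hd] at this
    have hab' := hab.symm
    cases hs : s n <;> cases ht : t n <;> simp_all
  simpa using lift_mk_le_lift_mk_of_injective hinj

theorem topWeight_le_aleph0_iff {X : Type u} [TopologicalSpace X] :
    topWeight X ≤ ℵ₀ ↔ SecondCountableTopology X := by
  constructor
  · intro h
    obtain ⟨B, hB, hBc⟩ : topWeight X ∈
        {κ : Cardinal.{u} | ∃ B : Set (Set X), IsTopologicalBasis B ∧ #B = κ} :=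
      csInf_mem ⟨_, _, isTopologicalBasis_opens, rfl⟩
    exact hB.secondCountableTopology (le_aleph0_iff_set_countable.1 (hBc.trans_le h))
  · intro h
    have hle : topWeight X ≤ #(countableBasis X) :=
      csInf_le' ⟨_, isBasis_countableBasis X, rfl⟩
    exact hle.trans (countable_countableBasis X).le_aleph0

/-- One separating coordinate for each of the countably many pairs of points embeds `X` into a
countable power of `L`. -/
theorem secondCountableTopology_of_countable_compact_pi {I : Type v} {L : Type u}
    [TopologicalSpace L] [T2Space L] [SecondCountableTopology L] {X : Type*} [TopologicalSpace X]
    [CompactSpace X] [Countable X] {f : X → I → L} (hf : Continuous f) (hinj : f.Injective) :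
    SecondCountableTopology X := by
  have h (a : {a : X × X // a.1 ≠ a.2}) : ∃ i, f a.1.1 i ≠ f a.1.2 i := by
    by_contra! h
    exact a.2 (hinj (funext h))
  choose k hk using h
  let g : X → {a : X × X // a.1 ≠ a.2} → L := fun x a => f x (k a)
  have hg : Continuous g := by fun_prop
  have hgi : g.Injective := by
    intro x y hxy
    by_contra hne
    exact hk ⟨(x, y), hne⟩ (congrFun hxy ⟨(x, y), hne⟩)
  exact (hg.isClosedEmbedding hgi).isEmbedding.secondCountableTopology

/-- A countable base at `y` involves only countably many coordinates, while `D` contains a point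
agreeing with `y` on all of them and differing at another. -/
theorem not_secondCountableTopology_of_interpolation {I : Type v} {L : Type u} [Uncountable I]
    [TopologicalSpace L] [T1Space L] [Nontrivial L] {D : Set (I → L)}
    (hD : ∀ J : Set I, J.Countable → ∀ y : I → L, ∃ d ∈ D, ∀ i ∈ J, d i = y i) :
    ¬ SecondCountableTopology D := by
  classical
  intro hsc
  obtain ⟨y, hy, -⟩ := hD ∅ Set.countable_empty fun _ => Classical.arbitrary L
  have h (B : {B // B ∈ countableBasis D ∧ (⟨y, hy⟩ : D) ∈ B}) :
      ∃ F : Finset I, ∀ d : D, (∀ i ∈ F, d.1 i = y i) → d ∈ B.1 := by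
    obtain ⟨U, hU, hUB⟩ := isOpen_induced_iff.1 ((isBasis_countableBasis D).isOpen B.2.1)
    have hyU : y ∈ U := by
      have := B.2.2
      rw [← hUB] at this
      exact this
    obtain ⟨F, u, hu, hsub⟩ := isOpen_pi_iff.1 hU y hyU
    refine ⟨F, fun d hd => ?_⟩
    rw [← hUB]
    exact hsub fun i hi => by rw [hd i hi]; exact (hu i hi).2
  choose F hF using h
  have : Countable {B // B ∈ countableBasis D ∧ (⟨y, hy⟩ : D) ∈ B} :=
    ((countable_countableBasis D).mono fun _ h => h.1).to_subtype
  have hJ : (⋃ B, (F B : Set I)).Countable :=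
    Set.countable_iUnion fun B => (F B).countable_toSet
  obtain ⟨i, hi⟩ : (⋃ B, (F B : Set I))ᶜ.Nonempty := by
    rw [Set.nonempty_compl]
    intro h
    exact Set.not_countable_univ (h ▸ hJ)
  obtain ⟨a, ha⟩ := exists_ne (y i)
  obtain ⟨d, hdD, hd⟩ := hD _ (hJ.insert i) (Function.update y i a)
  have hdi : d i = a := by simpa using hd i (Set.mem_insert _ _)
  have hopen : IsOpen {x : D | x.1 i ≠ a} :=
    isOpen_ne.preimage ((continuous_apply i).comp continuous_subtype_val)
  obtain ⟨B, hB, hyB, hsub⟩ := (isBasis_countableBasis D).exists_subset_of_mem_open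
    (show (⟨y, hy⟩ : D) ∈ {x : D | x.1 i ≠ a} from ha.symm) hopen
  refine hsub (hF ⟨B, hB, hyB⟩ ⟨d, hdD⟩ fun j hj => ?_) hdi
  have hjJ : j ∈ ⋃ B, (F B : Set I) := Set.mem_iUnion.2 ⟨⟨B, hB, hyB⟩, hj⟩
  have hne : j ≠ i := fun h => hi (h ▸ hjJ)
  simpa [hne] using hd j (Set.mem_insert_of_mem _ hjJ)

/-! ### Assembly of the theorem. -/

theorem mk_finsupp_int_le_continuum {Q : Type u} (hQ : #Q ≤ 𝔠) : #(Q →₀ ℤ) ≤ 𝔠 := by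
  cases finite_or_infinite Q
  · exact mk_le_aleph0.trans aleph0_le_continuum
  · rw [mk_finsupp_lift_of_infinite]
    exact max_le (lift_le_continuum.2 hQ)
      (lift_le_continuum.2 (mk_le_aleph0.trans aleph0_le_continuum))

theorem corollary5p4 {L : Type u} [AddCommGroup L] [TopologicalSpace L] [IsTopologicalAddGroup L]
    [CompactSpace L] [MetrizableSpace L] [Nontrivial L]
    {I : Type v} (hI : ℵ₀ < #I) (hI' : #I ≤ 𝔠) :
    (∃ D : AddSubgroup (I → L),
      IsGδDense (D : Set (I → L)) ∧ #D = 𝔠 ∧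
      (∀ C : Set D, IsCompact C → C.Countable) ∧ ¬ WCompact D) ∧
    (¬ AddMonoid.ExponentExists L →
      ∃ D : AddSubgroup (I → L),
        IsGδDense (D : Set (I → L)) ∧ #D = 𝔠 ∧
        (∀ C : Set D, IsCompact C → C.Countable) ∧ ¬ WCompact D ∧ Module.Free ℤ D) := by
  have : SecondCountableTopology L := by
    let _ := metrizableSpaceMetric L
    infer_instance
  have : Uncountable I := by rwa [← aleph0_lt_mk_iff]
  obtain ⟨Q, Φ, hΦ, hcomp, hker, hQ⟩ := exists_linearMap_finsupp (L := L) hI hI'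
  let D : AddSubgroup (I → L) := Φ.toAddMonoidHom.range
  have hD : ∀ J : Set I, J.Countable → ∀ y : I → L, ∃ d ∈ (D : Set (I → L)), ∀ i ∈ J, d i = y i :=
    fun J hJ y => by
      obtain ⟨p, hp⟩ := hΦ J hJ y
      exact ⟨Φ p, ⟨p, rfl⟩, hp⟩
  have hcard : #D = 𝔠 := by
    refine le_antisymm ?_ (continuum_le_mk_of_interpolation hD)
    have h := mk_le_of_surjective Φ.toAddMonoidHom.rangeRestrict_surjective
    exact h.trans (mk_finsupp_int_le_continuum hQ)
  have hDC (C : Set D) (hC : IsCompact C) : C.Countable := by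
    refine Set.countable_of_injective_of_countable_image Subtype.val_injective.injOn
      (hcomp (Subtype.val '' C) ?_ (hC.image continuous_subtype_val))
    rintro _ ⟨d, -, rfl⟩
    exact d.2
  have hw : ¬ WCompact D := by
    rintro ⟨C, hC, hCD⟩
    have := (hDC C hC).to_subtype
    have := isCompact_iff_compactSpace.1 hC
    have h1 : SecondCountableTopology C :=
      secondCountableTopology_of_countable_compact_pi (f := fun x : C => x.1.1)
        (continuous_subtype_val.comp continuous_subtype_val)
        (Subtype.val_injective.comp Subtype.val_injective)
    exact not_secondCountableTopology_of_interpolation hD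
      (topWeight_le_aleph0_iff.1 (hCD ▸ topWeight_le_aleph0_iff.2 h1))
  refine ⟨⟨D, isGδDense_of_interpolation hD, hcard, hDC, hw⟩, fun hL =>
    ⟨D, isGδDense_of_interpolation hD, hcard, hDC, hw, ?_⟩⟩
  have hinj : Function.Injective Φ := by
    refine (injective_iff_map_eq_zero _).2 fun p hp => ?_
    ext q
    by_contra hne
    refine hL ⟨(p q).natAbs, Int.natAbs_pos.2 hne, fun x => ?_⟩
    have := hker p hp q x
    rcases Int.natAbs_eq (p q) with h | h <;> rw [h] at this <;> simpa using this
  exact Module.Free.of_equiv (LinearEquiv.ofInjective Φ hinj)
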